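/- Let $D\subsetneq\mathbb{C}$ be a simply connected domain, and let $\lambda_D$ be the density of its hyperbolic metric of curvature $-4$: $\lambda_D(\varphi(\zeta))\,|\varphi'(\zeta)|=1/(1-|\zeta|^2)$ for $|\zeta|<1$, where $\varphi$ is a conformal mapping of the unit disk $\mathbb{D}$ onto $D$. For a locally univalent analytic function $F$ in $D$ put $P_F=F''/F'$ and $\|P_F\|_D=\sup_{z\in D}\lambda_D(z)^{-1}|P_F(z)|\in[0,\infty]$. Let $f=h+\overline{g}$ be a sense-preserving harmonic mapping in $D$, that is, $h$ and $g$ are analytic in $D$ and $|h'|^2-|g'|^2>0$ in $D$, and let $\omega_f=g'/h'$ be its dilatation. Then for all $\varepsilon_1,\varepsilon_2\in\overline{\mathbb{D}}$, $$\lambda_D(z)^{-1}\,\bigl|P_{h+\varepsilon_1 g}(z)-P_{h+\varepsilon_2 g}(z)\bigr|\le 2\sup_{w\in D}|\omega_f(w)|,\qquad z\in D. \tag{1}$$ Moreover, either $\|P_{h+\varepsilon_1 g}\|_D=\|P_{h+\varepsilon_2 g}\|_D=\infty$, or both $\|P_{h+\varepsilon_1 g}\|_D$ and $\|P_{h+\varepsilon_2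 g}\|_D$ are finite. If $\|P_{h+\varepsilon g}\|_D<\infty$ for some $\varepsilon\in\overline{\mathbb{D}}$, then for all $\varepsilon_1,\varepsilon_2\in\overline{\mathbb{D}}$, $$\bigl|\,\|P_{h+\varepsilon_1 g}\|_D-\|P_{h+\varepsilon_2 g}\|_D\,\bigr|\le 2\sup_{w\in D}|\omega_f(w)|. \tag{2}$$ Furthermore, for each $k\in[0,1]$ there exist $\varepsilon_1,\varepsilon_2\in\overline{\mathbb{D}}$ and a sense-preserving harmonic mapping $F=H+\overline{G}$ in $D$ with $\sup_{z\in D}|\omega_F(z)|=k$ such that, for $F$ in place of $f$, equality holds in (1) at some point $z\in D$ and, if $D$ is a disk, the two norms in (2) are finite and equality holds in (2). -/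

import Mathlib

open Set Metric
open scoped ENNReal ComplexConjugate

noncomputable section

/-- `φ` restricts to a conformal mapping (a holomorphic bijection) of the open unit disk onto `D`. -/
structure IsConformalFromDisk (φ : ℂ → ℂ) (D : Set ℂ) : Prop where
  differentiableOn : DifferentiableOn ℂ φ (ball 0 1)
  bijOn : BijOn φ (ball 0 1) D

open Classical in
/-- The density `λ_D` of the hyperbolic metric (of curvature `-4`) of a simply connected domain
`D ≠ ℂ`: if `φ` is a conformal mapping of the unit disk onto `D`, then
`λ_D (φ ζ) * |φ' ζ| = 1 / (1 - |ζ| ^ 2)` for all `ζ` in the unit disk. The value does not depend on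
the choice of `φ`, since two choices differ by a conformal automorphism of the disk. A conformal
`φ` exists by the Riemann mapping theorem; the value `0` is only a default for sets `D` that are
not conformally equivalent to the disk. -/
def hyperbolicDensity (D : Set ℂ) (w : ℂ) : ℝ :=
  if hD : ∃ φ : ℂ → ℂ, IsConformalFromDisk φ D then
    1 / ((1 - ‖Function.invFunOn hD.choose (ball 0 1) w‖ ^ 2) *
      ‖deriv hD.choose (Function.invFunOn hD.choose (ball 0 1) w)‖)
  else 0

/-- The Jacobian `|h'|² - |g'|²` of the harmonic mapping `h + conj g`. -/
def harmonicJacobian (h g : ℂ → ℂ) (z : ℂ) : ℝ :=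
  ‖deriv h z‖ ^ 2 - ‖deriv g z‖ ^ 2

/-- `f = h + conj g` is a sense-preserving harmonic mapping in the open set `D`, with analytic `h`
and `g`. -/
structure IsSensePreservingHarmonic (f h g : ℂ → ℂ) (D : Set ℂ) : Prop where
  analytic_left : DifferentiableOn ℂ h D
  analytic_right : DifferentiableOn ℂ g D
  decomposition : ∀ z ∈ D, f z = h z + conj (g z)
  jacobian_pos : ∀ z ∈ D, 0 < harmonicJacobian h g z

/-- The dilatation `ω_f = g' / h'` of `f = h + conj g`. -/
def dilatation (h g : ℂ → ℂ) (z : ℂ) : ℂ :=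
  deriv g z / deriv h z

/-- `sup_{z ∈ D} |ω_f z|`; the set of values is bounded by `1` when `f` is sense-preserving. -/
def dilatationSup (h g : ℂ → ℂ) (D : Set ℂ) : ℝ :=
  sSup ((fun z => ‖dilatation h g z‖) '' D)

/-- The pre-Schwarzian derivative `P_F = F'' / F'` of a locally univalent analytic function. -/
def preSchwarzian (F : ℂ → ℂ) (z : ℂ) : ℂ :=
  deriv (deriv F) z / deriv F z

/-- The pre-Schwarzian norm `sup_{z ∈ D} λ_D(z)⁻¹ |P_F z|`, a value in `[0, ∞]`. -/
def preSchwarzianNorm (F : ℂ → ℂ) (D : Set ℂ) : ℝ≥0∞ :=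
  ⨆ z ∈ D, ENNReal.ofReal ((hyperbolicDensity D z)⁻¹ * ‖preSchwarzian F z‖)

/-- The analytic function `h + ε g`. -/
def analyticCombination (h g : ℂ → ℂ) (ε : ℂ) (z : ℂ) : ℂ :=
  h z + ε * g z

end

open Filter Topology

/-! ### Injective holomorphic functions -/

/-! Write ω for the dilatation and K for sup |ω|. Since h' + εg' = h'(1 + εω), one has P_{h+εg} =
P_h + εω'/(1 + εω), so two such pre-Schwarzians differ by (ε₁ − ε₂)ω'/((1 + ε₁ω)(1 + ε₂ω))
(`preSchwarzian_analyticCombination_sub`). Schwarz–Pick for ω ∘ φ, sharpened by the bound K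
(`schwarz_pick_of_norm_le`), gives λ_D⁻¹|ω'| ≤ K(1 − |ω|²). What remains is a chord of the closed
unit disk, of length at most 2 (`norm_sub_mul_one_sub_normSq_le`). This is (1); the statements on
norms follow from the triangle inequality in [0, ∞].

For sharpness, take ω ∘ φ = kζ and H − G = z. Then P_{H−G} = 0, so by (1) the norm of P_{H+G} is at
most 2k, and the value at φ(0) attains it.

A conformal map φ comes from the Riemann mapping theorem: maximise |f'(a)| among injective f into
the disk with f(a) = 0. A maximiser exists by an ultrafilter limit and Hurwitz's theorem, and the
square root trick shows that it is surjective. -/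

theorem nhds_le_map_nhds_of_injOn {f : ℂ → ℂ} {U : Set ℂ} (hU : IsOpen U)
    (hf : DifferentiableOn ℂ f U) (hi : InjOn f U) {z : ℂ} (hz : z ∈ U) :
    𝓝 (f z) ≤ map f (𝓝 z) := by
  refine ((hf.analyticAt (hU.mem_nhds hz)).eventually_constant_or_nhds_le_map_nhds).resolve_left
    fun hc => ?_
  have h1 : ∀ᶠ w in 𝓝[≠] z, w ∈ U ∧ f w = f z ∧ w ≠ z :=
    (Filter.Eventually.filter_mono nhdsWithin_le_nhds (hU.eventually_mem hz)).and
      ((hc.filter_mono nhdsWithin_le_nhds).and self_mem_nhdsWithin)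
  obtain ⟨w, hw, hwz, hne⟩ := h1.exists
  exact hne (hi hw hz hwz)

theorem isOpen_image_of_injOn {f : ℂ → ℂ} {U : Set ℂ} (hU : IsOpen U)
    (hf : DifferentiableOn ℂ f U) (hi : InjOn f U) : IsOpen (f '' U) := by
  rw [isOpen_iff_mem_nhds]
  rintro _ ⟨z, hz, rfl⟩
  exact nhds_le_map_nhds_of_injOn hU hf hi hz (image_mem_map (hU.mem_nhds hz))

theorem continuousAt_leftInvOn {f g : ℂ → ℂ} {U : Set ℂ} (hU : IsOpen U)
    (hf : DifferentiableOn ℂ f U) (hg : LeftInvOn g f U) {z : ℂ} (hz : z ∈ U) :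
    ContinuousAt g (f z) := by
  have h := nhds_le_map_nhds_of_injOn hU hf hg.injOn hz
  rw [ContinuousAt, hg hz]
  refine (tendsto_map'_iff.2 ?_).mono_left h
  refine tendsto_id.congr' ?_
  filter_upwards [hU.mem_nhds hz] with w hw using (hg hw).symm

/-- At noncritical points this is the inverse function theorem. Critical points are isolated, since
otherwise f would be locally constant; the continuous inverse extends holomorphically across their
images by removability. Nonvanishing of f' is thus a consequence, not an ingredient. -/
theorem differentiableAt_leftInvOn {f g : ℂ → ℂ} {U : Set ℂ} (hU : IsOpen U)
    (hf : DifferentiableOn ℂ f U) (hg : LeftInvOn g f U) {z : ℂ} (hz : z ∈ U) :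
    DifferentiableAt ℂ g (f z) := by
  have hcrit : ∀ w ∈ U, deriv f w ≠ 0 → DifferentiableAt ℂ g (f w) := by
    intro w hw hne
    have hs : HasStrictDerivAt f (deriv f w) (g (f w)) := by
      rw [hg hw]
      exact ((hf.analyticAt (hU.mem_nhds hw)).hasStrictDerivAt)
    refine (HasStrictDerivAt.of_local_left_inverse (continuousAt_leftInvOn hU hf hg hw) hs hne
      ?_).hasDerivAt.differentiableAt
    filter_upwards [(isOpen_image_of_injOn hU hf hg.injOn).mem_nhds (mem_image_of_mem f hw)]
    rintro _ ⟨v, hv, rfl⟩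
    rw [hg hv]
  have hd : AnalyticAt ℂ (deriv f) z := (hf.analyticAt (hU.mem_nhds hz)).deriv
  have hne : ∀ᶠ w in 𝓝[≠] z, deriv f w ≠ 0 := by
    refine (hd.eventually_eq_zero_or_eventually_ne_zero).resolve_left fun h0 => ?_
    obtain ⟨r, hr, hball⟩ := Metric.eventually_nhds_iff_ball.1
      (h0.and (hU.mem_nhds hz : ∀ᶠ w in 𝓝 z, w ∈ U))
    have hconst : ∀ w ∈ ball z r, f w = f z := fun w hw =>
      (isOpen_ball.is_const_of_deriv_eq_zero (convex_ball z r).isPreconnected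
        (hf.mono fun v hv => (hball v hv).2) (fun v hv => (hball v hv).1) hw (mem_ball_self hr))
    have hpunct : ∀ᶠ w in 𝓝[≠] z, w ∈ ball z r ∧ w ≠ z :=
      (Filter.Eventually.filter_mono nhdsWithin_le_nhds
        (isOpen_ball.eventually_mem (mem_ball_self hr))).and self_mem_nhdsWithin
    obtain ⟨w, hw, hwz⟩ := hpunct.exists
    exact hwz (hg.injOn (hball w hw).2 hz (hconst w hw))
  obtain ⟨V, hV, hVne⟩ : ∃ V ∈ 𝓝 z, ∀ w ∈ V, w ≠ z → w ∈ U ∧ deriv f w ≠ 0 := by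
    refine ⟨_, (eventually_nhdsWithin_iff.1 hne).and (hU.mem_nhds hz), fun w hw hwz => ?_⟩
    exact ⟨hw.2, hw.1 hwz⟩
  have hs : f '' V ∈ 𝓝 (f z) :=
    nhds_le_map_nhds_of_injOn hU hf hg.injOn hz (image_mem_map hV)
  refine ((Complex.differentiableOn_compl_singleton_and_continuousAt_iff hs).1
    ⟨?_, continuousAt_leftInvOn hU hf hg hz⟩).differentiableAt hs
  rintro _ ⟨⟨w, hw, rfl⟩, hwz⟩
  have hwz' : w ≠ z := fun h => hwz (by rw [h]; rfl)
  exact (hcrit w (hVne w hw hwz').1 (hVne w hw hwz').2).differentiableWithinAt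

theorem deriv_mul_deriv_leftInvOn {f g : ℂ → ℂ} {U : Set ℂ} (hU : IsOpen U)
    (hf : DifferentiableOn ℂ f U) (hg : LeftInvOn g f U) {z : ℂ} (hz : z ∈ U) :
    deriv g (f z) * deriv f z = 1 := by
  have h1 := (differentiableAt_leftInvOn hU hf hg hz).hasDerivAt.comp z
    (hf.differentiableAt (hU.mem_nhds hz)).hasDerivAt
  have h2 : HasDerivAt (g ∘ f) 1 z := by
    refine (hasDerivAt_id z).congr_of_eventuallyEq ?_
    filter_upwards [hU.mem_nhds hz] with w hw using hg hw
  exact h1.unique h2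

theorem deriv_ne_zero_of_injOn {f : ℂ → ℂ} {U : Set ℂ} (hU : IsOpen U)
    (hf : DifferentiableOn ℂ f U) (hi : InjOn f U) {z : ℂ} (hz : z ∈ U) : deriv f z ≠ 0 := by
  intro h
  have := deriv_mul_deriv_leftInvOn hU hf hi.leftInvOn_invFunOn hz
  simp [h] at this

/-! ### Continuous square roots -/

/-- The slope of s is the slope of g = s² divided by s(w) + s(z), which tends to 2s(z). -/
theorem hasDerivAt_of_sq_eq {s g : ℂ → ℂ} {g' z : ℂ} (hs : ContinuousAt s z)
    (hsq : ∀ w, s w ^ 2 = g w) (hg : HasDerivAt g g' z) (h0 : s z ≠ 0) :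
    HasDerivAt s (g' / (2 * s z)) z := by
  rw [hasDerivAt_iff_tendsto_slope] at hg ⊢
  have hsum : Tendsto (fun w => s w + s z) (𝓝[≠] z) (𝓝 (2 * s z)) := by
    rw [two_mul]
    exact (hs.tendsto.add_const (s z)).mono_left nhdsWithin_le_nhds
  have h2 : 2 * s z ≠ 0 := mul_ne_zero two_ne_zero h0
  refine (hg.div hsum h2).congr' ?_
  filter_upwards [hsum.eventually_ne h2, self_mem_nhdsWithin] with w hw hwz
  have hwz' : w - z ≠ 0 := sub_ne_zero.2 hwz
  rw [Pi.div_apply, slope_def_field, slope_def_field, ← hsq, ← hsq]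
  field_simp
  ring

/-! ### Automorphisms of the unit disk -/

/-- The automorphism `z ↦ (z - b) / (1 - conj b * z)` of the unit disk. -/
noncomputable def diskAut (b z : ℂ) : ℂ := (z - b) / (1 - conj b * z)

theorem one_sub_conj_mul_ne_zero {b z : ℂ} (hb : ‖b‖ < 1) (hz : ‖z‖ < 1) :
    1 - conj b * z ≠ 0 := by
  intro h
  have h1 : ‖conj b * z‖ = 1 := by rw [← sub_eq_zero.1 h, norm_one]
  rw [norm_mul, RCLike.norm_conj] at h1
  nlinarith [norm_nonneg b, norm_nonneg z]

theorem normSq_one_sub_conj_mul (b z : ℂ) :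
    ‖1 - conj b * z‖ ^ 2 - ‖z - b‖ ^ 2 = (1 - ‖b‖ ^ 2) * (1 - ‖z‖ ^ 2) := by
  simp only [← Complex.normSq_eq_norm_sq, Complex.normSq_apply]
  simp
  ring

theorem norm_diskAut_lt_one {b z : ℂ} (hb : ‖b‖ < 1) (hz : ‖z‖ < 1) : ‖diskAut b z‖ < 1 := by
  have h0 := norm_pos_iff.2 (one_sub_conj_mul_ne_zero hb hz)
  rw [diskAut, norm_div, div_lt_one h0]
  refine lt_of_pow_lt_pow_left₀ 2 h0.le ?_
  have : 0 < (1 - ‖b‖ ^ 2) * (1 - ‖z‖ ^ 2) := by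
    apply mul_pos <;> nlinarith [norm_nonneg b, norm_nonneg z]
  linarith [normSq_one_sub_conj_mul b z]

theorem diskAut_self (b : ℂ) : diskAut b b = 0 := by simp [diskAut]

theorem diskAut_neg_zero (b : ℂ) : diskAut (-b) 0 = b := by simp [diskAut]

theorem diskAut_neg_diskAut {b z : ℂ} (hb : ‖b‖ < 1) (hz : ‖z‖ < 1) :
    diskAut (-b) (diskAut b z) = z := by
  have h1 := one_sub_conj_mul_ne_zero hb hz
  have h3 := one_sub_conj_mul_ne_zero hb hb
  unfold diskAut
  rw [map_neg]
  have h4 : 1 - -conj b * ((z - b) / (1 - conj b * z)) =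
      (1 - conj b * b) / (1 - conj b * z) := by
    field_simp
    ring
  have h5 : (z - b) / (1 - conj b * z) - -b = z * (1 - conj b * b) / (1 - conj b * z) := by
    rw [sub_neg_eq_add, div_add' _ _ _ h1]
    congr 1
    ring
  rw [h4, h5, div_div_div_cancel_right₀ h1, mul_div_cancel_right₀ _ h3]

theorem injOn_diskAut {b : ℂ} (hb : ‖b‖ < 1) : InjOn (diskAut b) (ball 0 1) := by
  intro z hz w hw h
  rw [← diskAut_neg_diskAut hb (mem_ball_zero_iff.1 hz), h,
    diskAut_neg_diskAut hb (mem_ball_zero_iff.1 hw)]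

theorem hasDerivAt_diskAut {b z : ℂ} (hb : ‖b‖ < 1) (hz : ‖z‖ < 1) :
    HasDerivAt (diskAut b) ((1 - ‖b‖ ^ 2) / (1 - conj b * z) ^ 2) z := by
  have h1 := one_sub_conj_mul_ne_zero hb hz
  refine (((hasDerivAt_id z).sub_const b).div
    (((hasDerivAt_id z).const_mul (conj b)).const_sub 1) h1).congr_deriv ?_
  rw [← Complex.conj_mul']
  simp only [id]
  congr 1
  ring

theorem hasDerivAt_diskAut_self {b : ℂ} (hb : ‖b‖ < 1) :
    HasDerivAt (diskAut b) (1 / (1 - ‖b‖ ^ 2)) b := by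
  have h := hasDerivAt_diskAut hb hb
  have h1 := one_sub_conj_mul_ne_zero hb hb
  rw [Complex.conj_mul'] at h h1
  convert h using 1
  field_simp

theorem mapsTo_diskAut {b : ℂ} (hb : ‖b‖ < 1) : MapsTo (diskAut b) (ball 0 1) (ball 0 1) :=
  fun _ hz => mem_ball_zero_iff.2 (norm_diskAut_lt_one hb (mem_ball_zero_iff.1 hz))

theorem differentiableOn_diskAut {b : ℂ} (hb : ‖b‖ < 1) :
    DifferentiableOn ℂ (diskAut b) (ball 0 1) := fun _ hz =>
  (hasDerivAt_diskAut hb (mem_ball_zero_iff.1 hz)).differentiableAt.differentiableWithinAt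

/-! ### The Riemann mapping theorem -/

/-- The competing functions in the extremal problem of the Riemann mapping theorem. -/
structure IsDiskEmbedding (U : Set ℂ) (a : ℂ) (f : ℂ → ℂ) : Prop where
  differentiableOn : DifferentiableOn ℂ f U
  mapsTo : MapsTo f U (ball 0 1)
  injOn : InjOn f U
  map_base : f a = 0

theorem isDiskEmbedding_diskAut_comp {U : Set ℂ} {a : ℂ} {f : ℂ → ℂ} (ha : a ∈ U)
    (hf : DifferentiableOn ℂ f U) (hm : MapsTo f U (ball 0 1)) (hi : InjOn f U) :
    IsDiskEmbedding U a (diskAut (f a) ∘ f) := by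
  have hb : ‖f a‖ < 1 := mem_ball_zero_iff.1 (hm ha)
  exact ⟨(differentiableOn_diskAut hb).comp hf hm, (mapsTo_diskAut hb).comp hm,
    (injOn_diskAut hb).comp hi hm, diskAut_self _⟩

/-- With c outside U, a branch s of √(z − c) is injective and never takes both v and −v. Its open
image contains a ball about s(a), hence misses the ball about −s(a), and inverting in that ball
gives a bounded injective map. -/
theorem exists_isDiskEmbedding {U : Set ℂ} {a : ℂ} (hUo : IsOpen U)
    (hUc : IsSimplyConnected U) (hU : U ≠ univ) (ha : a ∈ U) :
    ∃ f, IsDiskEmbedding U a f := by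
  obtain ⟨c, hc⟩ := (ne_univ_iff_exists_notMem U).1 hU
  obtain ⟨s, hsc, hs⟩ := Complex.exists_continuousOn_pow_eq hUc hUo
    (g := fun z => z - c) (by fun_prop)
    (by rintro ⟨z, hz, h⟩; exact hc (sub_eq_zero.1 h ▸ hz)) two_ne_zero
  have hs0 : ∀ z ∈ U, s z ≠ 0 := fun z hz h => hc <| by
    have := hs z
    rw [h, zero_pow two_ne_zero] at this
    exact sub_eq_zero.1 this.symm ▸ hz
  have hsd : DifferentiableOn ℂ s U := fun z hz =>
    (hasDerivAt_of_sq_eq (hsc.continuousAt (hUo.mem_nhds hz)) hs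
      ((hasDerivAt_id z).sub_const c) (hs0 z hz)).differentiableAt.differentiableWithinAt
  have hsi : InjOn s U := fun z _ w _ h => by
    have h1 := hs z
    rw [h, hs w] at h1
    exact (sub_left_injective h1).symm
  obtain ⟨ε, hε, hball⟩ := Metric.isOpen_iff.1 (isOpen_image_of_injOn hUo hsd hsi) (s a)
    (mem_image_of_mem s ha)
  have hfar : ∀ z ∈ U, ε ≤ ‖s z + s a‖ := by
    intro z hz
    by_contra! h
    obtain ⟨w, hw, hwz⟩ := @hball (-s z) (by
      rw [mem_ball, dist_eq_norm, ← norm_neg, show -(-s z - s a) = s z + s a by ring]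
      exact h)
    have hzw : z = w := by
      have h1 := hs w
      rw [hwz, neg_sq, hs z] at h1
      exact sub_left_injective h1
    subst hzw
    exact hs0 z hz (by linear_combination hwz / 2)
  have hne : ∀ z ∈ U, s z + s a ≠ 0 := fun z hz =>
    norm_pos_iff.1 (hε.trans_le (hfar z hz))
  refine ⟨_, isDiskEmbedding_diskAut_comp (f := fun z => ((ε / 2 : ℝ) : ℂ) / (s z + s a)) ha
    ((differentiableOn_const _).div (hsd.add_const _) hne) ?_ ?_⟩
  · intro z hz
    rw [mem_ball_zero_iff, norm_div, Complex.norm_real, Real.norm_of_nonneg (by positivity),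
      div_lt_one (hε.trans_le (hfar z hz))]
    linarith [hfar z hz]
  · intro z hz w hw h
    exact hsi hz hw (by simpa [div_eq_mul_inv, hε.ne'] using h)

/-- Koebe's trick: move an omitted value w to 0, take a square root, and renormalise at a. With r =
√|w|, the derivative at a is multiplied in modulus by (1 + r²)/(2r) > 1. -/
theorem IsDiskEmbedding.exists_norm_deriv_lt {U : Set ℂ} {a : ℂ} {f : ℂ → ℂ} (hUo : IsOpen U)
    (hUc : IsSimplyConnected U) (ha : a ∈ U) (hf : IsDiskEmbedding U a f)
    (hns : ¬ SurjOn f U (ball 0 1)) :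
    ∃ g, IsDiskEmbedding U a g ∧ ‖deriv f a‖ < ‖deriv g a‖ := by
  obtain ⟨w, hw, hwf⟩ := not_subset.1 hns
  rw [mem_ball_zero_iff] at hw
  have hfn : ∀ z ∈ U, ‖f z‖ < 1 := fun z hz => mem_ball_zero_iff.1 (hf.mapsTo hz)
  set g : ℂ → ℂ := diskAut w ∘ f with hgdef
  have hgd : DifferentiableOn ℂ g U := (differentiableOn_diskAut hw).comp hf.differentiableOn
    hf.mapsTo
  have hgn : ∀ z ∈ U, ‖g z‖ < 1 := fun z hz => norm_diskAut_lt_one hw (hfn z hz)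
  have hg0 : ∀ z ∈ U, g z ≠ 0 := by
    intro z hz h
    refine hwf ⟨z, hz, injOn_diskAut hw (hf.mapsTo hz) (mem_ball_zero_iff.2 hw) ?_⟩
    rw [diskAut_self]
    exact h
  obtain ⟨s, hsc, hs⟩ := Complex.exists_continuousOn_pow_eq hUc hUo hgd.continuousOn
    (by rintro ⟨z, hz, h⟩; exact hg0 z hz h) two_ne_zero
  have hs0 : ∀ z ∈ U, s z ≠ 0 := fun z hz h => hg0 z hz <| by
    rw [← hs z, h, zero_pow two_ne_zero]
  have hsd' : ∀ z ∈ U, HasDerivAt s (deriv g z / (2 * s z)) z := fun z hz =>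
    hasDerivAt_of_sq_eq (hsc.continuousAt (hUo.mem_nhds hz)) hs
      (hgd.differentiableAt (hUo.mem_nhds hz)).hasDerivAt (hs0 z hz)
  have hsn : ∀ z ∈ U, ‖s z‖ < 1 := fun z hz => by
    have := hgn z hz
    rw [← hs z, norm_pow] at this
    exact (pow_lt_one_iff_of_nonneg (norm_nonneg _) two_ne_zero).1 this
  have hsi : InjOn s U := fun z hz v hv h => by
    refine hf.injOn hz hv (injOn_diskAut hw (hf.mapsTo hz) (hf.mapsTo hv) ?_)
    have := hs z
    rw [h, hs v] at this
    exact this.symm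
  refine ⟨_, isDiskEmbedding_diskAut_comp ha
    (fun z hz => (hsd' z hz).differentiableAt.differentiableWithinAt)
    (fun z hz => mem_ball_zero_iff.2 (hsn z hz)) hsi, ?_⟩
  have hga : g a = -w := by simp [hgdef, hf.map_base, diskAut]
  have hsa : ‖s a‖ ^ 2 = ‖w‖ := by rw [← norm_pow, hs a, hga, norm_neg]
  have hfa : HasDerivAt f (deriv f a) a :=
    (hf.differentiableOn.differentiableAt (hUo.mem_nhds ha)).hasDerivAt
  have hgda : deriv g a = (1 - ‖w‖ ^ 2) * deriv f a := by
    have h := (hasDerivAt_diskAut hw (hfn a ha)).comp a hfa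
    rw [hf.map_base, mul_zero, sub_zero, one_pow, div_one] at h
    exact h.deriv
  have hda : deriv (diskAut (s a) ∘ s) a =
      1 / (1 - ‖s a‖ ^ 2) * (deriv g a / (2 * s a)) :=
    ((hasDerivAt_diskAut_self (hsn a ha)).comp a (hsd' a ha)).deriv
  have hf0 : 0 < ‖deriv f a‖ :=
    norm_pos_iff.2 (deriv_ne_zero_of_injOn hUo hf.differentiableOn hf.injOn ha)
  set r := ‖s a‖ with hr
  have hr0 : 0 < r := norm_pos_iff.2 (hs0 a ha)
  have hr1 : r < 1 := hsn a ha
  have hnorm : ‖deriv (diskAut (s a) ∘ s) a‖ = (1 + r ^ 2) / (2 * r) * ‖deriv f a‖ := by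
    have e1 : ‖(1 - (r : ℂ) ^ 2)‖ = 1 - r ^ 2 := by
      rw [show (1 - (r : ℂ) ^ 2) = ((1 - r ^ 2 : ℝ) : ℂ) by push_cast; ring, Complex.norm_real,
        Real.norm_of_nonneg (by nlinarith)]
    have e2 : ‖(1 - (‖w‖ : ℂ) ^ 2)‖ = 1 - (r ^ 2) ^ 2 := by
      rw [← hsa, show (1 - ((r ^ 2 : ℝ) : ℂ) ^ 2) = ((1 - (r ^ 2) ^ 2 : ℝ) : ℂ) by push_cast; ring,
        Complex.norm_real, Real.norm_of_nonneg]
      have : r ^ 2 < 1 := by nlinarith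
      nlinarith [sq_nonneg r]
    rw [hda, hgda, norm_mul, norm_div, norm_div, norm_mul, norm_mul, norm_one, e1, e2,
      Complex.norm_ofNat, ← hr]
    have : 1 - r ^ 2 ≠ 0 := by nlinarith
    field_simp
    ring
  rw [hnorm]
  refine lt_mul_of_one_lt_left hf0 ?_
  rw [one_lt_div (by positivity)]
  nlinarith [sq_pos_of_pos (sub_pos.2 hr1)]

theorem IsDiskEmbedding.norm_deriv_le {U : Set ℂ} {a : ℂ} {f : ℂ → ℂ} {r : ℝ} (hr : 0 < r)
    (hball : ball a r ⊆ U) (hf : IsDiskEmbedding U a f) : ‖deriv f a‖ ≤ 1 / r := by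
  refine Complex.norm_deriv_le_div_of_mapsTo_ball (hf.differentiableOn.mono hball) ?_ hr
  rw [hf.map_base]
  exact fun z hz => ball_subset_closedBall (hf.mapsTo (hball hz))

/-! ### Limits of bounded and of injective holomorphic functions. -/

/-- The Schwarz lemma gives a Lipschitz bound at each point that is uniform in the index, so the
family is equicontinuous and pointwise convergence becomes uniform on compact sets. The 2 in `2 / r`
bounds the distance between two values of modulus at most 1. -/
theorem tendstoLocallyUniformlyOn_of_norm_le_one {ι : Type*} {l : Filter ι} {U : Set ℂ}
    {F : ι → ℂ → ℂ} {f : ℂ → ℂ} (hU : IsOpen U) (hF : ∀ i, DifferentiableOn ℂ (F i) U)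
    (hb : ∀ i, ∀ z ∈ U, ‖F i z‖ ≤ 1) (hlim : ∀ z ∈ U, Tendsto (fun i => F i z) l (𝓝 (f z))) :
    TendstoLocallyUniformlyOn F f l U := by
  rw [tendstoLocallyUniformlyOn_iff_forall_isCompact hU]
  intro K hKU hK
  have heq : ∀ x ∈ U, EquicontinuousAt F x := by
    intro x hx
    obtain ⟨r, hr, hball⟩ := Metric.isOpen_iff.1 hU x hx
    refine Metric.equicontinuousAt_of_continuity_modulus (fun z => 2 / r * dist x z) ?_ F ?_
    · have : Continuous fun z => 2 / r * dist x z := by fun_prop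
      simpa using this.tendsto x
    · filter_upwards [ball_mem_nhds x hr] with z hz i
      rw [dist_comm, dist_comm x]
      refine Complex.dist_le_div_mul_dist_of_mapsTo_ball ((hF i).mono hball) ?_ hz
      intro w hw
      rw [mem_closedBall, dist_eq_norm]
      linarith [norm_sub_le (F i w) (F i x), hb i w (hball hw), hb i x hx]
  have := (EquicontinuousOn.tendsto_uniformOnFun_iff_pi' (𝔖 := {K}) (F := F)
    (by simpa using hK) (by
      simp only [mem_singleton_iff, forall_eq]
      exact fun x hx => (heq x (hKU hx)).equicontinuousWithinAt K) l f).2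
    (tendsto_pi_nhds.2 fun x => hlim x (hKU (by simpa using x.2)))
  exact (UniformOnFun.tendsto_iff_tendstoUniformlyOn.1 this) K rfl

/-- **Hurwitz's theorem** on locally uniform limits of injective holomorphic functions. -/
theorem injOn_of_tendstoLocallyUniformlyOn {ι : Type*} {l : Filter ι} [l.NeBot] {U : Set ℂ}
    {F : ι → ℂ → ℂ} {f : ℂ → ℂ} (hU : IsOpen U) (hUc : IsPreconnected U)
    (hF : ∀ i, DifferentiableOn ℂ (F i) U) (hi : ∀ i, InjOn (F i) U)
    (hlim : TendstoLocallyUniformlyOn F f l U) (hnc : ∀ c, ¬ ∀ z ∈ U, f z = c) :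
    InjOn f U := by
  have hfd : DifferentiableOn ℂ f U := hlim.differentiableOn (.of_forall hF) hU
  have hfa : AnalyticOnNhd ℂ f U := hfd.analyticOnNhd hU
  intro a ha b hb hab
  by_contra hne
  have hiso : ∀ᶠ z in 𝓝[≠] b, f z ≠ f b := by
    refine ((hfa b hb).eventually_eq_or_eventually_ne analyticAt_const).resolve_left fun h => ?_
    exact hnc (f b) (hfa.eqOn_of_preconnected_of_eventuallyEq (fun _ _ => analyticAt_const) hUc hb h)
  -- Isolate b among the solutions of f = f(b), in a ball that avoids a.
  obtain ⟨ρ, hρ, hball⟩ := Metric.eventually_nhds_iff_ball.1 <|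
    (eventually_nhdsWithin_iff.1 hiso).and
      ((hU.eventually_mem hb).and (isOpen_ne.eventually_mem (Ne.symm hne)))
  set r := ρ / 2 with hr
  have hr0 : 0 < r := half_pos hρ
  have hsub : closedBall b r ⊆ ball b ρ := closedBall_subset_ball (by linarith)
  have hKU : closedBall b r ⊆ U := fun z hz => (hball z (hsub hz)).2.1
  obtain ⟨m, hm, hmle⟩ : ∃ m > 0, ∀ z ∈ sphere b r, m ≤ ‖f z - f b‖ := by
    have hcont : ContinuousOn (fun z => ‖f z - f b‖) (sphere b r) :=
      ((hfd.continuousOn.mono (sphere_subset_closedBall.trans hKU)).sub continuousOn_const).norm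
    obtain ⟨x, hx, hmin⟩ := (isCompact_sphere b r).exists_isMinOn
      (NormedSpace.sphere_nonempty.2 hr0.le) hcont
    refine ⟨‖f x - f b‖, norm_pos_iff.2 (sub_ne_zero.2 ?_), hmin⟩
    refine (hball x (hsub (sphere_subset_closedBall hx))).1 ?_
    rintro rfl
    simp [hr0.ne] at hx
  have hunif := (tendstoLocallyUniformlyOn_iff_forall_isCompact hU).1 hlim _
    (insert_subset ha hKU) ((isCompact_closedBall b r).insert a)
  obtain ⟨i, hclose⟩ := (Metric.tendstoUniformlyOn_iff.1 hunif (m / 16) (by positivity)).exists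
  have hca := hclose a (mem_insert a _)
  have hcb := hclose b (mem_insert_of_mem a (mem_closedBall_self hr0.le))
  -- Quantitative open mapping: a lower bound m/2 for |F_i − F_i(b)| on the circle puts the ball of
  -- radius m/4 about F_i(b) in the image of the disk. As f(a) = f(b), the value F_i(a) lies within
  -- m/8 of F_i(b), so it is taken again near b, against injectivity.
  have himg := DiffContOnCl.ball_subset_image_closedBall (f := F i) (z₀ := b) (r := r)
    (ε := m / 2) ?_ hr0 ?_ ?_
  · obtain ⟨z, hz, hza⟩ := @himg (F i a) (by
      rw [mem_ball]
      calc dist (F i a) (F i b) ≤ dist (F i a) (f a) + dist (f a) (F i b) := dist_triangle _ _ _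
        _ < m / 16 + m / 16 := by
          exact add_lt_add (by rwa [dist_comm] at hca) (by rwa [hab])
        _ < m / 2 / 2 := by linarith)
    exact (hball z (hsub hz)).2.2 (hi i (hKU hz) ha hza)
  · exact ((hF i).mono hKU).diffContOnCl_ball Subset.rfl
  · intro z hz
    have hcz := hclose z (mem_insert_of_mem a (sphere_subset_closedBall hz))
    rw [dist_eq_norm] at hcz hcb
    have h1 := hmle z hz
    have h2 : ‖f z - f b‖ ≤ ‖f z - F i z‖ + ‖F i z - F i b‖ + ‖f b - F i b‖ := by
      calc ‖f z - f b‖ = ‖(f z - F i z) + (F i z - F i b) - (f b - F i b)‖ := by congr 1; ring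
        _ ≤ _ := (norm_sub_le _ _).trans (by gcongr; exact norm_add_le _ _)
    linarith
  · have : ∀ᶠ z in 𝓝[≠] b, F i z ≠ F i b := by
      filter_upwards [mem_nhdsWithin_of_mem_nhds (hU.mem_nhds hb), self_mem_nhdsWithin]
        with z hz hzb h using hzb (hi i hz hb h)
    exact this.frequently.filter_mono nhdsWithin_le_nhds

theorem exists_isDiskEmbedding_maximal {U : Set ℂ} {a : ℂ} (hUo : IsOpen U)
    (hUc : IsPreconnected U) (ha : a ∈ U) (hex : ∃ f, IsDiskEmbedding U a f) :
    ∃ f, IsDiskEmbedding U a f ∧ ∀ g, IsDiskEmbedding U a g → ‖deriv g a‖ ≤ ‖deriv f a‖ := by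
  obtain ⟨r, hr, hball⟩ := Metric.isOpen_iff.1 hUo a ha
  set S : Set ℝ := (fun f => ‖deriv f a‖) '' {f | IsDiskEmbedding U a f} with hS
  have hbdd : BddAbove S := ⟨1 / r, by
    rintro _ ⟨f, hf, rfl⟩
    exact IsDiskEmbedding.norm_deriv_le hr hball hf⟩
  obtain ⟨f₀, hf₀⟩ := hex
  have hne : S.Nonempty := ⟨_, f₀, hf₀, rfl⟩
  have hpos : 0 < sSup S := lt_of_lt_of_le
    (norm_pos_iff.2 (deriv_ne_zero_of_injOn hUo hf₀.differentiableOn hf₀.injOn ha))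
    (le_csSup hbdd ⟨f₀, hf₀, rfl⟩)
  obtain ⟨u, -, hu, huS⟩ := exists_seq_tendsto_sSup hne hbdd
  choose F hF hFu using huS
  have hFn : ∀ n, ∀ z ∈ U, F n z ∈ closedBall (0 : ℂ) 1 := fun n z hz =>
    ball_subset_closedBall ((hF n).mapsTo hz)
  -- Along an ultrafilter every bounded sequence of values converges, so the pointwise limit exists
  -- without extracting subsequences.
  set l : Ultrafilter ℕ := hyperfilter ℕ
  have hptw : ∀ z : ℂ, ∃ w, z ∈ U → Tendsto (fun n => F n z) l (𝓝 w) := by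
    intro z
    by_cases hz : z ∈ U
    · obtain ⟨w, -, hw⟩ := (isCompact_closedBall (0 : ℂ) 1).ultrafilter_le_nhds
        (l.map fun n => F n z) (by
          rw [Ultrafilter.coe_map, le_principal_iff]
          exact mem_map.2 (univ_mem' fun n => hFn n z hz))
      exact ⟨w, fun _ => hw⟩
    · exact ⟨0, fun h => absurd h hz⟩
  choose f hf using hptw
  have hlim : TendstoLocallyUniformlyOn F f l U := tendstoLocallyUniformlyOn_of_norm_le_one hUo
    (fun n => (hF n).differentiableOn) (fun n z hz => mem_closedBall_zero_iff.1 (hFn n z hz)) hf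
  have hfd : DifferentiableOn ℂ f U :=
    hlim.differentiableOn (.of_forall fun n => (hF n).differentiableOn) hUo
  have hder : ‖deriv f a‖ = sSup S := by
    have h1 : Tendsto (fun n => deriv (F n) a) l (𝓝 (deriv f a)) :=
      (hlim.deriv (.of_forall fun n => (hF n).differentiableOn) hUo).tendsto_at ha
    have h2 : Tendsto u l (𝓝 (sSup S)) := hu.mono_left Nat.hyperfilter_le_atTop
    refine tendsto_nhds_unique h1.norm (h2.congr fun n => (hFu n).symm)
  -- Hurwitz needs a nonconstant limit; |f'(a)| is the positive supremum.
  have hnc : ∀ c, ¬ ∀ z ∈ U, f z = c := by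
    intro c hc
    have : f =ᶠ[𝓝 a] fun _ => c := by
      filter_upwards [hUo.mem_nhds ha] with z hz using hc z hz
    rw [this.deriv_eq, deriv_const, norm_zero] at hder
    exact hpos.ne hder
  have hinj : InjOn f U := injOn_of_tendstoLocallyUniformlyOn hUo hUc
    (fun n => (hF n).differentiableOn) (fun n => (hF n).injOn) hlim hnc
  refine ⟨f, ⟨hfd, ?_, hinj, ?_⟩, fun g hg => hder ▸ le_csSup hbdd ⟨g, hg, rfl⟩⟩
  · have hcl : f '' U ⊆ closedBall 0 1 := by
      rintro _ ⟨z, hz, rfl⟩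
      exact isClosed_closedBall.mem_of_tendsto (hf z hz) (.of_forall fun n => hFn n z hz)
    -- The limit values lie a priori only in the closed disk; the image is open, hence inside its
    -- interior.
    have := interior_maximal hcl (isOpen_image_of_injOn hUo hfd hinj)
    rw [interior_closedBall _ one_ne_zero] at this
    exact fun z hz => this (mem_image_of_mem f hz)
  · refine tendsto_nhds_unique (hf a ha) ?_
    simp only [(hF _).map_base]
    exact tendsto_const_nhds

/-- The **Riemann mapping theorem**. -/
theorem exists_isConformalFromDisk {U : Set ℂ} (hUo : IsOpen U) (hUc : IsSimplyConnected U)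
    (hU : U ≠ univ) : ∃ φ, IsConformalFromDisk φ U := by
  obtain ⟨a, ha⟩ := hUc.nonempty
  obtain ⟨f, hf, hmax⟩ := exists_isDiskEmbedding_maximal hUo
    hUc.isPathConnected.isConnected.isPreconnected ha (exists_isDiskEmbedding hUo hUc hU ha)
  have hsurj : SurjOn f U (ball 0 1) := by
    by_contra h
    obtain ⟨g, hg, hlt⟩ := hf.exists_norm_deriv_lt hUo hUc ha h
    exact (hmax g hg).not_gt hlt
  have hbij : BijOn f U (ball 0 1) := ⟨hf.mapsTo, hf.injOn, hsurj⟩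
  refine ⟨Function.invFunOn f U, ?_, hbij.invOn_invFunOn.symm.bijOn
    hbij.surjOn.mapsTo_invFunOn hf.mapsTo⟩
  intro w hw
  obtain ⟨z, hz, rfl⟩ := hsurj hw
  exact (differentiableAt_leftInvOn hUo hf.differentiableOn hf.injOn.leftInvOn_invFunOn
    hz).differentiableWithinAt

/-! ### The Schwarz-Pick inequality -/

/-- Conjugating by disk automorphisms moves ζ and F(ζ) to 0, where the Schwarz lemma applies. -/
theorem schwarz_pick {F : ℂ → ℂ} (hF : DifferentiableOn ℂ F (ball 0 1))
    (hm : MapsTo F (ball 0 1) (ball 0 1)) {ζ : ℂ} (hζ : ζ ∈ ball (0 : ℂ) 1) :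
    (1 - ‖ζ‖ ^ 2) * ‖deriv F ζ‖ ≤ 1 - ‖F ζ‖ ^ 2 := by
  have hz : ‖ζ‖ < 1 := mem_ball_zero_iff.1 hζ
  have hz' : ‖-ζ‖ < 1 := by rwa [norm_neg]
  have hw : ‖F ζ‖ < 1 := mem_ball_zero_iff.1 (hm hζ)
  set u : ℂ → ℂ := diskAut (F ζ) ∘ F ∘ diskAut (-ζ) with hu
  have hud : DifferentiableOn ℂ u (ball 0 1) := (differentiableOn_diskAut hw).comp
    (hF.comp (differentiableOn_diskAut hz') (mapsTo_diskAut hz'))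
    (hm.comp (mapsTo_diskAut hz'))
  have hum : MapsTo u (ball 0 1) (ball 0 1) :=
    (mapsTo_diskAut hw).comp (hm.comp (mapsTo_diskAut hz'))
  have hu0 : u 0 = 0 := by simp [hu, diskAut_neg_zero, diskAut_self]
  have h1 : ‖deriv u 0‖ ≤ 1 := Complex.norm_deriv_le_one_of_mapsTo_ball hud
    (by rw [hu0]; exact hum.mono_right ball_subset_closedBall) one_pos
  have hd1 : HasDerivAt (diskAut (-ζ)) (1 - (‖ζ‖ : ℂ) ^ 2) 0 := by
    simpa using hasDerivAt_diskAut hz' (z := 0) (by simp)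
  have hd2 : HasDerivAt F (deriv F ζ) (diskAut (-ζ) 0) := by
    rw [diskAut_neg_zero]
    exact (hF.differentiableAt (isOpen_ball.mem_nhds hζ)).hasDerivAt
  have hd3 : HasDerivAt (diskAut (F ζ)) (1 / (1 - (‖F ζ‖ : ℂ) ^ 2)) ((F ∘ diskAut (-ζ)) 0) := by
    rw [Function.comp_apply, diskAut_neg_zero]
    exact hasDerivAt_diskAut_self hw
  have hp : ∀ v : ℂ, ‖v‖ < 1 → 0 < 1 - ‖v‖ ^ 2 := fun v hv => by nlinarith [norm_nonneg v]
  have hnorm : ∀ v : ℂ, ‖v‖ < 1 → ‖(1 - (‖v‖ : ℂ) ^ 2)‖ = 1 - ‖v‖ ^ 2 := fun v hv => by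
    rw [show (1 - (‖v‖ : ℂ) ^ 2) = ((1 - ‖v‖ ^ 2 : ℝ) : ℂ) by push_cast; ring, Complex.norm_real,
      Real.norm_of_nonneg (hp v hv).le]
  rw [hu, (hd3.comp 0 (hd2.comp 0 hd1)).deriv, norm_mul, norm_mul, norm_div, norm_one,
    hnorm _ hw, hnorm _ hz, one_div, inv_mul_le_iff₀ (hp _ hw)] at h1
  linarith

/-- For K < t < 1, Schwarz–Pick applied to F/t gives the bound t − |F|²/t ≤ t(1 − |F|²). Letting t
decrease to K keeps F/t inside the open disk and also covers K = 0. -/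
theorem schwarz_pick_of_norm_le {F : ℂ → ℂ} {K : ℝ} (hF : DifferentiableOn ℂ F (ball 0 1))
    (hm : MapsTo F (ball 0 1) (ball 0 1)) (hK1 : K ≤ 1) (hK : ∀ ζ ∈ ball (0 : ℂ) 1, ‖F ζ‖ ≤ K)
    {ζ : ℂ} (hζ : ζ ∈ ball (0 : ℂ) 1) :
    (1 - ‖ζ‖ ^ 2) * ‖deriv F ζ‖ ≤ K * (1 - ‖F ζ‖ ^ 2) := by
  rcases hK1.eq_or_lt with rfl | hlt
  · simpa using schwarz_pick hF hm hζ
  have hK0 : 0 ≤ K := (norm_nonneg _).trans (hK ζ hζ)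
  have hlim : Tendsto (fun t => t * (1 - ‖F ζ‖ ^ 2)) (𝓝[>] K) (𝓝 (K * (1 - ‖F ζ‖ ^ 2))) :=
    (tendsto_id.mul_const _).mono_left nhdsWithin_le_nhds
  refine ge_of_tendsto hlim ?_
  filter_upwards [Ioo_mem_nhdsGT hlt] with t ht
  have ht0 : 0 < t := hK0.trans_lt ht.1
  have hn : ∀ v : ℂ, ‖v / t‖ = ‖v‖ / t := fun v => by
    rw [norm_div, Complex.norm_real, Real.norm_of_nonneg ht0.le]
  have h := schwarz_pick (F := fun z => F z / t) (hF.div_const _) (fun z hz => by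
    rw [mem_ball_zero_iff, hn, div_lt_one ht0]
    exact (hK z hz).trans_lt ht.1) hζ
  rw [deriv_div_const, hn, hn] at h
  have h2 : (1 - ‖ζ‖ ^ 2) * ‖deriv F ζ‖ ≤ t - ‖F ζ‖ ^ 2 / t := by
    calc (1 - ‖ζ‖ ^ 2) * ‖deriv F ζ‖ = t * ((1 - ‖ζ‖ ^ 2) * (‖deriv F ζ‖ / t)) := by field_simp
      _ ≤ t * (1 - (‖F ζ‖ / t) ^ 2) := by gcongr
      _ = _ := by field_simp
  have h3 : t * ‖F ζ‖ ^ 2 ≤ ‖F ζ‖ ^ 2 / t := by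
    rw [le_div_iff₀ ht0]
    nlinarith [sq_nonneg ‖F ζ‖, ht.2, mul_self_nonneg (1 - t),
      mul_nonneg (sq_nonneg ‖F ζ‖) (show 0 ≤ 1 - t * t by nlinarith [ht.2])]
  linarith

/-! ### Elementary inequalities for 1 + εw. -/

theorem norm_add_conj_le {ε w : ℂ} (hε : ‖ε‖ ≤ 1) (hw : ‖w‖ < 1) :
    ‖ε + conj w‖ ≤ ‖1 + ε * w‖ := by
  refine le_of_sq_le_sq ?_ (norm_nonneg _)
  have h := normSq_one_sub_conj_mul (-conj w) ε
  simp only [map_neg, Complex.conj_conj, norm_neg, RCLike.norm_conj, sub_neg_eq_add, neg_mul] at h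
  rw [mul_comm w] at h
  have : 0 ≤ (1 - ‖w‖ ^ 2) * (1 - ‖ε‖ ^ 2) :=
    mul_nonneg (by nlinarith [norm_nonneg w]) (by nlinarith [norm_nonneg ε])
  linarith

theorem one_add_mul_ne_zero {ε w : ℂ} (hε : ‖ε‖ ≤ 1) (hw : ‖w‖ < 1) : 1 + ε * w ≠ 0 := by
  intro h
  have h1 : ‖ε * w‖ = 1 := by rw [eq_neg_of_add_eq_zero_right h, norm_neg, norm_one]
  rw [norm_mul] at h1
  nlinarith [norm_nonneg ε, norm_nonneg w]

/-- The map ε ↦ (ε + conj w)/(1 + εw) sends the closed disk into itself, so two of its values differ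
by at most 2; clearing denominators in that difference gives the identity `hid`. -/
theorem norm_sub_mul_one_sub_normSq_le {ε₁ ε₂ w : ℂ} (h₁ : ‖ε₁‖ ≤ 1) (h₂ : ‖ε₂‖ ≤ 1) (hw : ‖w‖ < 1) :
    ‖ε₁ - ε₂‖ * (1 - ‖w‖ ^ 2) ≤ 2 * (‖1 + ε₁ * w‖ * ‖1 + ε₂ * w‖) := by
  have hid : (ε₁ - ε₂) * ((1 - ‖w‖ ^ 2 : ℝ) : ℂ) =
      (ε₁ + conj w) * (1 + ε₂ * w) - (ε₂ + conj w) * (1 + ε₁ * w) := by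
    push_cast
    rw [← Complex.conj_mul']
    ring
  have hp : 0 ≤ 1 - ‖w‖ ^ 2 := by nlinarith [norm_nonneg w]
  calc ‖ε₁ - ε₂‖ * (1 - ‖w‖ ^ 2) = ‖(ε₁ - ε₂) * ((1 - ‖w‖ ^ 2 : ℝ) : ℂ)‖ := by
        rw [norm_mul, Complex.norm_real, Real.norm_of_nonneg hp]
    _ ≤ ‖ε₁ + conj w‖ * ‖1 + ε₂ * w‖ + ‖ε₂ + conj w‖ * ‖1 + ε₁ * w‖ := by
        rw [hid]
        refine (norm_sub_le _ _).trans ?_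
        rw [norm_mul, norm_mul]
    _ ≤ ‖1 + ε₁ * w‖ * ‖1 + ε₂ * w‖ + ‖1 + ε₂ * w‖ * ‖1 + ε₁ * w‖ := by
        gcongr
        exacts [norm_add_conj_le h₁ hw, norm_add_conj_le h₂ hw]
    _ = _ := by ring

/-! ### The hyperbolic density -/

/-- Working with the map chosen in the definition makes independence of that choice unnecessary. -/
theorem exists_conformal_hyperbolicDensity_eq {D : Set ℂ} (hD : ∃ φ, IsConformalFromDisk φ D) :
    ∃ φ, IsConformalFromDisk φ D ∧ ∀ ζ ∈ ball (0 : ℂ) 1,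
      (hyperbolicDensity D (φ ζ))⁻¹ = (1 - ‖ζ‖ ^ 2) * ‖deriv φ ζ‖ := by
  refine ⟨hD.choose, hD.choose_spec, fun ζ hζ => ?_⟩
  rw [hyperbolicDensity, dif_pos hD, hD.choose_spec.bijOn.injOn.leftInvOn_invFunOn hζ, one_div,
    inv_inv]

theorem hyperbolicDensity_nonneg (D : Set ℂ) (hD : ∃ φ, IsConformalFromDisk φ D) {z : ℂ}
    (hz : z ∈ D) : 0 ≤ hyperbolicDensity D z := by
  obtain ⟨φ, hφ, hden⟩ := exists_conformal_hyperbolicDensity_eq hD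
  obtain ⟨ζ, hζ, rfl⟩ := hφ.bijOn.surjOn hz
  rw [← inv_nonneg, hden ζ hζ]
  have := mem_ball_zero_iff.1 hζ
  exact mul_nonneg (by nlinarith [norm_nonneg ζ]) (norm_nonneg _)

/-! ### Pre-Schwarzian derivatives of the analytic combinations -/

namespace IsSensePreservingHarmonic

variable {f h g : ℂ → ℂ} {D : Set ℂ}

theorem norm_deriv_lt (hf : IsSensePreservingHarmonic f h g D) {z : ℂ} (hz : z ∈ D) :
    ‖deriv g z‖ < ‖deriv h z‖ := by
  have := hf.jacobian_pos z hz
  rw [harmonicJacobian, sub_pos] at this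
  exact lt_of_pow_lt_pow_left₀ 2 (norm_nonneg _) this

theorem deriv_ne_zero (hf : IsSensePreservingHarmonic f h g D) {z : ℂ} (hz : z ∈ D) :
    deriv h z ≠ 0 :=
  norm_pos_iff.1 ((norm_nonneg _).trans_lt (hf.norm_deriv_lt hz))

theorem norm_dilatation_lt_one (hf : IsSensePreservingHarmonic f h g D) {z : ℂ} (hz : z ∈ D) :
    ‖dilatation h g z‖ < 1 := by
  rw [dilatation, norm_div, div_lt_one (norm_pos_iff.2 (hf.deriv_ne_zero hz))]
  exact hf.norm_deriv_lt hz

theorem norm_dilatation_le_dilatationSup (hf : IsSensePreservingHarmonic f h g D) {z : ℂ}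
    (hz : z ∈ D) : ‖dilatation h g z‖ ≤ dilatationSup h g D :=
  le_csSup ⟨1, by rintro _ ⟨w, hw, rfl⟩; exact (hf.norm_dilatation_lt_one hw).le⟩ ⟨z, hz, rfl⟩

theorem dilatationSup_le_one (hf : IsSensePreservingHarmonic f h g D) :
    dilatationSup h g D ≤ 1 :=
  Real.sSup_le (by rintro _ ⟨w, hw, rfl⟩; exact (hf.norm_dilatation_lt_one hw).le) zero_le_one

theorem differentiableOn_dilatation (hD : IsOpen D) (hf : IsSensePreservingHarmonic f h g D) :
    DifferentiableOn ℂ (dilatation h g) D :=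
  (hf.analytic_right.deriv hD).div (hf.analytic_left.deriv hD) fun _ hz => hf.deriv_ne_zero hz

theorem preSchwarzian_analyticCombination_sub (hD : IsOpen D)
    (hf : IsSensePreservingHarmonic f h g D) {ε₁ ε₂ : ℂ} (h₁ : ‖ε₁‖ ≤ 1) (h₂ : ‖ε₂‖ ≤ 1) {z : ℂ}
    (hz : z ∈ D) :
    preSchwarzian (analyticCombination h g ε₁) z - preSchwarzian (analyticCombination h g ε₂) z =
      (ε₁ - ε₂) * deriv (dilatation h g) z /
        ((1 + ε₁ * dilatation h g z) * (1 + ε₂ * dilatation h g z)) := by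
  have hh := hf.analytic_left
  have hg := hf.analytic_right
  have hd : ∀ ε, ∀ w ∈ D, deriv (analyticCombination h g ε) w = deriv h w + ε * deriv g w := by
    intro ε w hw
    exact ((hh.differentiableAt (hD.mem_nhds hw)).hasDerivAt.add
      ((hg.differentiableAt (hD.mem_nhds hw)).hasDerivAt.const_mul ε)).deriv
  have hh2 := ((hh.deriv hD).differentiableAt (hD.mem_nhds hz)).hasDerivAt
  have hg2 := ((hg.deriv hD).differentiableAt (hD.mem_nhds hz)).hasDerivAt
  have hdd : ∀ ε, deriv (deriv (analyticCombination h g ε)) z =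
      deriv (deriv h) z + ε * deriv (deriv g) z := by
    intro ε
    have heq : deriv (analyticCombination h g ε) =ᶠ[𝓝 z] fun w => deriv h w + ε * deriv g w := by
      filter_upwards [hD.mem_nhds hz] with w hw using hd ε w hw
    rw [heq.deriv_eq]
    exact (hh2.add (hg2.const_mul ε)).deriv
  have h0 := hf.deriv_ne_zero hz
  have hω : deriv (dilatation h g) z =
      (deriv (deriv g) z * deriv h z - deriv g z * deriv (deriv h) z) / deriv h z ^ 2 :=
    (hg2.div hh2 h0).deriv
  have hfac : ∀ ε, deriv h z + ε * deriv g z = deriv h z * (1 + ε * dilatation h g z) := by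
    intro ε
    rw [dilatation]
    field_simp
  have hn1 := one_add_mul_ne_zero h₁ (hf.norm_dilatation_lt_one hz)
  have hn2 := one_add_mul_ne_zero h₂ (hf.norm_dilatation_lt_one hz)
  have hm1 := mul_ne_zero h0 hn1
  have hm2 := mul_ne_zero h0 hn2
  rw [preSchwarzian, preSchwarzian, hdd, hdd, hd _ z hz, hd _ z hz, hω]
  rw [hfac, hfac, div_sub_div _ _ hm1 hm2, ← mul_div_assoc, div_div, ← hfac, ← hfac]
  rw [← hfac] at hm1 hm2
  congr 1
  · ring
  · rw [hfac, hfac]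
    ring

/-- Pulling back by φ turns λ_D⁻¹|ω'| into (1 − |ζ|²)|(ω ∘ φ)'|. Sharpened Schwarz–Pick produces the
factor 1 − |ω|² that the chord inequality absorbs. -/
theorem density_inv_mul_norm_preSchwarzian_sub_le (hD : IsOpen D)
    (hconf : ∃ φ, IsConformalFromDisk φ D) (hf : IsSensePreservingHarmonic f h g D)
    {ε₁ ε₂ : ℂ} (h₁ : ‖ε₁‖ ≤ 1) (h₂ : ‖ε₂‖ ≤ 1) {z : ℂ} (hz : z ∈ D) :
    (hyperbolicDensity D z)⁻¹ * ‖preSchwarzian (analyticCombination h g ε₁) z -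
      preSchwarzian (analyticCombination h g ε₂) z‖ ≤ 2 * dilatationSup h g D := by
  obtain ⟨φ, hφ, hden⟩ := exists_conformal_hyperbolicDensity_eq hconf
  obtain ⟨ζ, hζ, rfl⟩ := hφ.bijOn.surjOn hz
  have hωd := hf.differentiableOn_dilatation hD
  have hder : deriv (dilatation h g ∘ φ) ζ = deriv (dilatation h g) (φ ζ) * deriv φ ζ :=
    ((hωd.differentiableAt (hD.mem_nhds hz)).hasDerivAt.comp ζ
      (hφ.differentiableOn.differentiableAt (isOpen_ball.mem_nhds hζ)).hasDerivAt).deriv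
  have hsp := schwarz_pick_of_norm_le (F := dilatation h g ∘ φ)
    (hωd.comp hφ.differentiableOn hφ.bijOn.mapsTo)
    (fun v hv => mem_ball_zero_iff.2 (hf.norm_dilatation_lt_one (hφ.bijOn.mapsTo hv)))
    hf.dilatationSup_le_one
    (fun v hv => hf.norm_dilatation_le_dilatationSup (hφ.bijOn.mapsTo hv)) hζ
  rw [hder, norm_mul, Function.comp_apply] at hsp
  have hw := hf.norm_dilatation_lt_one hz
  rw [hden ζ hζ, hf.preSchwarzian_analyticCombination_sub hD h₁ h₂ hz, norm_div, norm_mul,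
    norm_mul]
  have hK0 : 0 ≤ dilatationSup h g D :=
    (norm_nonneg _).trans (hf.norm_dilatation_le_dilatationSup hz)
  have hchord := norm_sub_mul_one_sub_normSq_le h₁ h₂ hw
  have hq : 0 < ‖1 + ε₁ * dilatation h g (φ ζ)‖ * ‖1 + ε₂ * dilatation h g (φ ζ)‖ :=
    mul_pos (norm_pos_iff.2 (one_add_mul_ne_zero h₁ hw))
      (norm_pos_iff.2 (one_add_mul_ne_zero h₂ hw))
  rw [← mul_div_assoc, div_le_iff₀ hq]
  calc (1 - ‖ζ‖ ^ 2) * ‖deriv φ ζ‖ * (‖ε₁ - ε₂‖ * ‖deriv (dilatation h g) (φ ζ)‖)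
      = (1 - ‖ζ‖ ^ 2) * (‖deriv (dilatation h g) (φ ζ)‖ * ‖deriv φ ζ‖) * ‖ε₁ - ε₂‖ := by ring
    _ ≤ dilatationSup h g D * (1 - ‖dilatation h g (φ ζ)‖ ^ 2) * ‖ε₁ - ε₂‖ := by gcongr
    _ = dilatationSup h g D * (‖ε₁ - ε₂‖ * (1 - ‖dilatation h g (φ ζ)‖ ^ 2)) := by ring
    _ ≤ dilatationSup h g D * (2 * (‖1 + ε₁ * dilatation h g (φ ζ)‖ *
          ‖1 + ε₂ * dilatation h g (φ ζ)‖)) := by gcongr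
    _ = _ := by ring

theorem preSchwarzianNorm_le_add (hD : IsOpen D)
    (hconf : ∃ φ, IsConformalFromDisk φ D) (hf : IsSensePreservingHarmonic f h g D)
    {ε₁ ε₂ : ℂ} (h₁ : ‖ε₁‖ ≤ 1) (h₂ : ‖ε₂‖ ≤ 1) :
    preSchwarzianNorm (analyticCombination h g ε₁) D ≤
      preSchwarzianNorm (analyticCombination h g ε₂) D +
        ENNReal.ofReal (2 * dilatationSup h g D) := by
  refine iSup₂_le fun z hz => ?_
  have hden := inv_nonneg.2 (hyperbolicDensity_nonneg D hconf hz)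
  calc ENNReal.ofReal ((hyperbolicDensity D z)⁻¹ *
          ‖preSchwarzian (analyticCombination h g ε₁) z‖)
      ≤ ENNReal.ofReal ((hyperbolicDensity D z)⁻¹ *
          ‖preSchwarzian (analyticCombination h g ε₂) z‖ + 2 * dilatationSup h g D) := by
        refine ENNReal.ofReal_le_ofReal ?_
        have hb := hf.density_inv_mul_norm_preSchwarzian_sub_le hD hconf h₁ h₂ hz
        have htri := mul_le_mul_of_nonneg_left
          (norm_le_norm_add_norm_sub' (preSchwarzian (analyticCombination h g ε₁) z)
            (preSchwarzian (analyticCombination h g ε₂) z)) hden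
        rw [mul_add] at htri
        linarith
    _ ≤ _ := ENNReal.ofReal_add_le
    _ ≤ _ := by
        gcongr
        exact le_iSup₂ (f := fun z (_ : z ∈ D) => ENNReal.ofReal ((hyperbolicDensity D z)⁻¹ *
          ‖preSchwarzian (analyticCombination h g ε₂) z‖)) z hz

end IsSensePreservingHarmonic

/-! ### The extremal mappings -/

/-- The conditions G' = ωH' and H' − G' = 1 force H' = 1/(1 − ω). With ω = kζ, a primitive Φ of
φ'/(1 − kζ) exists on the disk, and H is Φ composed with the inverse of φ. -/
theorem exists_sensePreservingHarmonic_dilatation {D : Set ℂ} {φ : ℂ → ℂ}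
    (hφ : IsConformalFromDisk φ D) {k : ℝ} (hk : k ∈ Icc (0 : ℝ) 1) :
    ∃ H : ℂ → ℂ, IsSensePreservingHarmonic (fun z => H z + conj (H z - z)) H (fun z => H z - z) D ∧
      ∀ ζ ∈ ball (0 : ℂ) 1, dilatation H (fun z => H z - z) (φ ζ) = k * ζ := by
  have hφd : ∀ ζ ∈ ball (0 : ℂ) 1, DifferentiableAt ℂ φ ζ := fun ζ hζ =>
    hφ.differentiableOn.differentiableAt (isOpen_ball.mem_nhds hζ)
  have hkn : ∀ ζ ∈ ball (0 : ℂ) 1, ‖(k : ℂ) * ζ‖ < 1 := by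
    intro ζ hζ
    rw [norm_mul, Complex.norm_real, Real.norm_of_nonneg hk.1]
    have := mem_ball_zero_iff.1 hζ
    nlinarith [hk.2, norm_nonneg ζ]
  have hk0 : ∀ ζ ∈ ball (0 : ℂ) 1, 1 - k * ζ ≠ 0 := by
    intro ζ hζ h
    have := hkn ζ hζ
    rw [← sub_eq_zero.1 h, norm_one] at this
    exact lt_irrefl _ this
  obtain ⟨Φ, hΦ⟩ := DifferentiableOn.isExactOn_ball (f := fun ζ => deriv φ ζ / (1 - k * ζ))
    (c := 0) (r := 1) ((hφ.differentiableOn.deriv isOpen_ball).div (by fun_prop) hk0)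
  set ψ := Function.invFunOn φ (ball 0 1)
  have hψ : LeftInvOn ψ φ (ball 0 1) := hφ.bijOn.injOn.leftInvOn_invFunOn
  have hH : ∀ ζ ∈ ball (0 : ℂ) 1, HasDerivAt (Φ ∘ ψ) (1 / (1 - k * ζ)) (φ ζ) := by
    intro ζ hζ
    have h1 := (differentiableAt_leftInvOn isOpen_ball hφ.differentiableOn hψ hζ).hasDerivAt
    have h2 := hΦ ζ hζ
    rw [← hψ hζ] at h2
    refine (h2.comp (φ ζ) h1).congr_deriv ?_
    rw [hψ hζ, div_mul_eq_mul_div, mul_comm,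
      deriv_mul_deriv_leftInvOn isOpen_ball hφ.differentiableOn hψ hζ]
  have hG : ∀ ζ ∈ ball (0 : ℂ) 1,
      HasDerivAt (fun z => (Φ ∘ ψ) z - z) (k * ζ / (1 - k * ζ)) (φ ζ) := by
    intro ζ hζ
    refine ((hH ζ hζ).sub (hasDerivAt_id _)).congr_deriv ?_
    have := hk0 ζ hζ
    field_simp
    ring
  refine ⟨Φ ∘ ψ, ⟨?_, ?_, fun z _ => rfl, ?_⟩, ?_⟩
  · intro z hz
    obtain ⟨ζ, hζ, rfl⟩ := hφ.bijOn.surjOn hz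
    exact (hH ζ hζ).differentiableAt.differentiableWithinAt
  · intro z hz
    obtain ⟨ζ, hζ, rfl⟩ := hφ.bijOn.surjOn hz
    exact (hG ζ hζ).differentiableAt.differentiableWithinAt
  · intro z hz
    obtain ⟨ζ, hζ, rfl⟩ := hφ.bijOn.surjOn hz
    have h0 := norm_pos_iff.2 (hk0 ζ hζ)
    rw [harmonicJacobian, (hH ζ hζ).deriv, (hG ζ hζ).deriv, norm_div, norm_div, norm_one, sub_pos]
    have := hkn ζ hζ
    gcongr
  · intro ζ hζ
    rw [dilatation, (hH ζ hζ).deriv, (hG ζ hζ).deriv, div_div_div_cancel_right₀ (hk0 ζ hζ), div_one]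

theorem dilatationSup_eq {D : Set ℂ} {φ h g : ℂ → ℂ} (hφ : IsConformalFromDisk φ D) {k : ℝ}
    (hk : 0 ≤ k) (hω : ∀ ζ ∈ ball (0 : ℂ) 1, dilatation h g (φ ζ) = k * ζ) :
    dilatationSup h g D = k := by
  have hn : ∀ ζ ∈ ball (0 : ℂ) 1, ‖dilatation h g (φ ζ)‖ = k * ‖ζ‖ := fun ζ hζ => by
    rw [hω ζ hζ, norm_mul, Complex.norm_real, Real.norm_of_nonneg hk]
  have h0 : (0 : ℂ) ∈ ball (0 : ℂ) 1 := mem_ball_self one_pos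
  refine IsLUB.csSup_eq ⟨?_, ?_⟩ ⟨_, φ 0, hφ.bijOn.mapsTo h0, rfl⟩
  · rintro _ ⟨z, hz, rfl⟩
    obtain ⟨ζ, hζ, rfl⟩ := hφ.bijOn.surjOn hz
    simp only [hn ζ hζ]
    exact mul_le_of_le_one_right hk (mem_ball_zero_iff.1 hζ).le
  · intro b hb
    have hlim : Tendsto (fun t : ℝ => k * t) (𝓝[<] 1) (𝓝 k) := by
      have : Tendsto (fun t : ℝ => k * t) (𝓝 1) (𝓝 (k * 1)) := tendsto_id.const_mul k
      rw [mul_one] at this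
      exact this.mono_left nhdsWithin_le_nhds
    refine le_of_tendsto hlim ?_
    filter_upwards [Ioo_mem_nhdsLT (zero_lt_one' ℝ)] with t ht
    have htn : ‖(t : ℂ)‖ = t := by rw [Complex.norm_real, Real.norm_of_nonneg ht.1.le]
    have htb : (t : ℂ) ∈ ball (0 : ℂ) 1 := mem_ball_zero_iff.2 (htn.trans_lt ht.2)
    have := hb ⟨φ t, hφ.bijOn.mapsTo htb, rfl⟩
    simpa only [hn _ htb, htn] using this

theorem preSchwarzian_analyticCombination_neg_one (H : ℂ → ℂ) (z : ℂ) :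
    preSchwarzian (analyticCombination H (fun w => H w - w) (-1)) z = 0 := by
  have : analyticCombination H (fun w => H w - w) (-1) = id := by
    funext w
    simp [analyticCombination]
  have h1 : deriv (id : ℂ → ℂ) = fun _ => 1 := by
    funext w
    exact deriv_id w
  rw [preSchwarzian, this, h1, deriv_const, zero_div]

/-! ### The main theorem. -/

theorem corollary2 (D : Set ℂ) (hDo : IsOpen D) (hDs : IsSimplyConnected D) (hD : D ≠ univ) :
    (∀ f h g : ℂ → ℂ, IsSensePreservingHarmonic f h g D →
      (∀ ε₁ ∈ closedBall (0 : ℂ) 1, ∀ ε₂ ∈ closedBall (0 : ℂ) 1,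
        (∀ z ∈ D,
          (hyperbolicDensity D z)⁻¹ *
              ‖preSchwarzian (analyticCombination h g ε₁) z -
                preSchwarzian (analyticCombination h g ε₂) z‖ ≤
            2 * dilatationSup h g D) ∧
        ((preSchwarzianNorm (analyticCombination h g ε₁) D = ⊤ ∧
            preSchwarzianNorm (analyticCombination h g ε₂) D = ⊤) ∨
          (preSchwarzianNorm (analyticCombination h g ε₁) D < ⊤ ∧
            preSchwarzianNorm (analyticCombination h g ε₂) D < ⊤))) ∧
      ((∃ ε ∈ closedBall (0 : ℂ) 1,
          preSchwarzianNorm (analyticCombination h g ε) D < ⊤) →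
        ∀ ε₁ ∈ closedBall (0 : ℂ) 1, ∀ ε₂ ∈ closedBall (0 : ℂ) 1,
          |(preSchwarzianNorm (analyticCombination h g ε₁) D).toReal -
              (preSchwarzianNorm (analyticCombination h g ε₂) D).toReal| ≤
            2 * dilatationSup h g D)) ∧
    (∀ k ∈ Icc (0 : ℝ) 1,
      ∃ ε₁ ∈ closedBall (0 : ℂ) 1, ∃ ε₂ ∈ closedBall (0 : ℂ) 1, ∃ F H G : ℂ → ℂ,
        IsSensePreservingHarmonic F H G D ∧
        dilatationSup H G D = k ∧
        (∃ z ∈ D,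
          (hyperbolicDensity D z)⁻¹ *
              ‖preSchwarzian (analyticCombination H G ε₁) z -
                preSchwarzian (analyticCombination H G ε₂) z‖ =
            2 * dilatationSup H G D) ∧
        ((∃ (c : ℂ) (r : ℝ), 0 < r ∧ D = ball c r) →
          preSchwarzianNorm (analyticCombination H G ε₁) D < ⊤ ∧
          preSchwarzianNorm (analyticCombination H G ε₂) D < ⊤ ∧
          |(preSchwarzianNorm (analyticCombination H G ε₁) D).toReal -
              (preSchwarzianNorm (analyticCombination H G ε₂) D).toReal| =
            2 * dilatationSup H G D)) := by
  have hconf := exists_isConformalFromDisk hDo hDs hD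
  refine ⟨fun f h g hf => ?_, fun k hk => ?_⟩
  · have hle : ∀ ε₁ ∈ closedBall (0 : ℂ) 1, ∀ ε₂ ∈ closedBall (0 : ℂ) 1,
        preSchwarzianNorm (analyticCombination h g ε₁) D ≤
          preSchwarzianNorm (analyticCombination h g ε₂) D +
            ENNReal.ofReal (2 * dilatationSup h g D) := fun ε₁ h₁ ε₂ h₂ =>
      hf.preSchwarzianNorm_le_add hDo hconf (mem_closedBall_zero_iff.1 h₁)
        (mem_closedBall_zero_iff.1 h₂)
    have hfin : ∀ ε₁ ∈ closedBall (0 : ℂ) 1, ∀ ε₂ ∈ closedBall (0 : ℂ) 1,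
        preSchwarzianNorm (analyticCombination h g ε₂) D < ⊤ →
          preSchwarzianNorm (analyticCombination h g ε₁) D < ⊤ := fun ε₁ h₁ ε₂ h₂ hlt =>
      (hle ε₁ h₁ ε₂ h₂).trans_lt (ENNReal.add_lt_top.2 ⟨hlt, ENNReal.ofReal_lt_top⟩)
    refine ⟨fun ε₁ h₁ ε₂ h₂ => ⟨fun z hz => ?_, ?_⟩, ?_⟩
    · exact hf.density_inv_mul_norm_preSchwarzian_sub_le hDo hconf (mem_closedBall_zero_iff.1 h₁)
        (mem_closedBall_zero_iff.1 h₂) hz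
    · by_cases h : preSchwarzianNorm (analyticCombination h g ε₁) D < ⊤
      · exact Or.inr ⟨h, hfin ε₂ h₂ ε₁ h₁ h⟩
      · exact Or.inl ⟨not_lt_top_iff.1 h, not_lt_top_iff.1 fun h' => h (hfin ε₁ h₁ ε₂ h₂ h')⟩
    · rintro ⟨ε, hε, hlt⟩
      obtain ⟨z, hz⟩ := hDs.nonempty
      have hK : 0 ≤ 2 * dilatationSup h g D := mul_nonneg zero_le_two
        ((norm_nonneg _).trans (hf.norm_dilatation_le_dilatationSup hz))
      have hreal : ∀ ε₁ ∈ closedBall (0 : ℂ) 1, ∀ ε₂ ∈ closedBall (0 : ℂ) 1,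
          (preSchwarzianNorm (analyticCombination h g ε₁) D).toReal ≤
            (preSchwarzianNorm (analyticCombination h g ε₂) D).toReal +
              2 * dilatationSup h g D := by
        intro ε₁ h₁ ε₂ h₂
        have hlt₂ := hfin ε₂ h₂ ε hε hlt
        have := ENNReal.toReal_mono
          (ENNReal.add_lt_top.2 ⟨hlt₂, ENNReal.ofReal_lt_top⟩).ne (hle ε₁ h₁ ε₂ h₂)
        rwa [ENNReal.toReal_add hlt₂.ne ENNReal.ofReal_ne_top, ENNReal.toReal_ofReal hK] at this
      intro ε₁ h₁ ε₂ h₂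
      rw [abs_le]
      constructor <;> linarith [hreal ε₁ h₁ ε₂ h₂, hreal ε₂ h₂ ε₁ h₁]
  · obtain ⟨φ, hφ, hden⟩ := exists_conformal_hyperbolicDensity_eq hconf
    obtain ⟨H, hF, hω⟩ := exists_sensePreservingHarmonic_dilatation hφ hk
    have hsup := dilatationSup_eq hφ hk.1 hω
    have h0 : (0 : ℂ) ∈ ball (0 : ℂ) 1 := mem_ball_self one_pos
    have hz := hφ.bijOn.mapsTo h0
    have hn₁ : ‖(1 : ℂ)‖ ≤ 1 := norm_one.le
    have hn₂ : ‖(-1 : ℂ)‖ ≤ 1 := by rw [norm_neg, norm_one]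
    have hωd : deriv (dilatation H fun z => H z - z) (φ 0) * deriv φ 0 = k := by
      have hc := ((hF.differentiableOn_dilatation hDo).differentiableAt
        (hDo.mem_nhds hz)).hasDerivAt.comp 0
          (hφ.differentiableOn.differentiableAt (isOpen_ball.mem_nhds h0)).hasDerivAt
      have hl : HasDerivAt ((dilatation H fun z => H z - z) ∘ φ) (k : ℂ) 0 := by
        have hlin : HasDerivAt (fun ζ : ℂ => k * ζ) (k : ℂ) 0 := by
          simpa using (hasDerivAt_id (0 : ℂ)).const_mul (k : ℂ)
        refine hlin.congr_of_eventuallyEq ?_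
        filter_upwards [isOpen_ball.mem_nhds h0] with ζ hζ using hω ζ hζ
      exact hc.unique hl
    have heq : (hyperbolicDensity D (φ 0))⁻¹ *
        ‖preSchwarzian (analyticCombination H (fun z => H z - z) 1) (φ 0) -
          preSchwarzian (analyticCombination H (fun z => H z - z) (-1)) (φ 0)‖ =
        2 * dilatationSup H (fun z => H z - z) D := by
      -- At φ(0) the dilatation vanishes, so both denominators are 1; the factor 2 is |1 − (−1)|.
      rw [hF.preSchwarzian_analyticCombination_sub hDo hn₁ hn₂ hz, hden 0 h0, hω 0 h0, hsup]
      have hnk : ‖deriv (dilatation H fun z => H z - z) (φ 0)‖ * ‖deriv φ 0‖ = k := by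
        rw [← norm_mul, hωd, Complex.norm_real, Real.norm_of_nonneg hk.1]
      have h2 : ‖(1 : ℂ) - -1‖ = 2 := by norm_num
      rw [mul_zero, mul_zero, mul_zero, add_zero, mul_one, div_one, norm_mul, h2, norm_zero]
      linear_combination 2 * hnk
    have hnorm₂ : preSchwarzianNorm (analyticCombination H (fun z => H z - z) (-1)) D = 0 := by
      simp [preSchwarzianNorm, preSchwarzian_analyticCombination_neg_one]
    -- The upper bound is the general inequality compared with the zero norm at ε = −1; the lower
    -- bound is the value at φ(0).
    have hnorm₁ : preSchwarzianNorm (analyticCombination H (fun z => H z - z) 1) D =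
        ENNReal.ofReal (2 * dilatationSup H (fun z => H z - z) D) := by
      refine le_antisymm ?_ ?_
      · simpa [hnorm₂] using hF.preSchwarzianNorm_le_add hDo hconf hn₁ hn₂
      · rw [← heq, preSchwarzian_analyticCombination_neg_one, sub_zero]
        exact le_iSup₂ (f := fun z (_ : z ∈ D) => ENNReal.ofReal ((hyperbolicDensity D z)⁻¹ *
          ‖preSchwarzian (analyticCombination H (fun z => H z - z) 1) z‖)) (φ 0) hz
    refine ⟨1, mem_closedBall_zero_iff.2 hn₁, -1, mem_closedBall_zero_iff.2 hn₂, _, H,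
      fun z => H z - z, hF, hsup, ⟨φ 0, hz, heq⟩, fun _ => ?_⟩
    have hK : 0 ≤ 2 * dilatationSup H (fun z => H z - z) D :=
      mul_nonneg zero_le_two (hsup ▸ hk.1)
    rw [hnorm₁, hnorm₂]
    refine ⟨ENNReal.ofReal_lt_top, ENNReal.zero_lt_top, ?_⟩
    rw [ENNReal.toReal_ofReal hK, ENNReal.toReal_zero, sub_zero, abs_of_nonneg hK]
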